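/- A delta-matroid is a pair $D=(E,\mathcal F)$, where $E$ is a finite set and $\mathcal F$ is a non-empty collection of subsets of $E$ (the feasible sets) such that for all $X,Y\in\mathcal F$ and $u\in X\bigtriangleup Y$ there is $v\in X\bigtriangleup Y$ (possibly $v=u$) with $X\bigtriangleup\{u,v\}\in\mathcal F$. Let $\prec$ be a total order on $E$. For a feasible set $F$, an element $e\in E$ is active with respect to $F$ if $F\bigtriangleup\{e\}\notin\mathcal F$ and there is no $f\prec e$ with $F\bigtriangleup\{e,f\}\in\mathcal F$. Let $\mathrm{int}_\prec(F)$ be the set of active elements that belong to $F$, let $\mathrm{ext}_\prec(F)$ be the set of active elements that do not belong to $F$, and let $$I(F):=[F-\mathrm{int}_\prec(F),\,F\cup\mathrm{ext}_\prec(F)]=\{X : F-\mathrm{int}_\prec(F)\subseteq X\subseteq F\cup\mathrm{ext}_\prec(F)\}.$$ Theorem. For every delta-matroid $D=(E,\mathcal F)$ and every total order $\prec$ on $E$, the Boolean intervals $I(F)$, one for each feasible set $F\in\mathcal F$, form a partition of $2^E$; that is, they are non-empty, intervals of distinct feasible sets are distinct and disjoint, and every subset of $E$ lies in one of them. This generalizes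 Crapo's interval partition for matroids: if $M$ is a matroid on a finite set $E$ with a total order $\prec$, then $E$ together with the set of bases of $M$ is a delta-matroid. For every basis $B$ of $M$, the set $\mathrm{int}_\prec(B)$ defined above consists of the elements $e\in B$ that are least in the fundamental cocircuit $C^*(B,e)\subseteq (E-B)\cup\{e\}$, and $\mathrm{ext}_\prec(B)$ consists of the elements $e\in E-B$ that are least in the fundamental circuit $C(B,e)\subseteq B\cup\{e\}$. Consequently Crapo's intervals $[B-\mathrm{int}_\prec(B),\,B\cup\mathrm{ext}_\prec(B)]$, one for each basis $B$, form a partition of $2^E$. -/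

import Mathlib

/-- A delta-matroid on the element set `E` (which is finite wherever this is used): a non-empty
collection of feasible subsets of `E` satisfying the symmetric exchange axiom. -/
structure DeltaMatroid (E : Type*) where
  feasible : Set (Set E)
  nonempty : feasible.Nonempty
  exchange : ∀ X ∈ feasible, ∀ Y ∈ feasible, ∀ u ∈ symmDiff X Y,
    ∃ v ∈ symmDiff X Y, symmDiff X {u, v} ∈ feasible

namespace DeltaMatroid

/-- `e` is `F`-orientable if `F ∆ {e}` is not feasible. -/
def Orientable {E : Type*} (D : DeltaMatroid E) (F : Set E) (e : E) : Prop :=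
  symmDiff F {e} ∉ D.feasible

/-- `e` is `F`-interlaced with `f`: the elements are distinct, `e` is `F`-orientable, and
`F ∆ {e, f}` is feasible. -/
def Interlaced {E : Type*} (D : DeltaMatroid E) (F : Set E) (e f : E) : Prop :=
  e ≠ f ∧ D.Orientable F e ∧ symmDiff F {e, f} ∈ D.feasible

/-- `e` is active with respect to `F` (a feasible set): `e` is `F`-orientable and is not
`F`-interlaced with any smaller element. -/
def Active {E : Type*} [LinearOrder E] (D : DeltaMatroid E) (F : Set E) (e : E) : Prop :=
  D.Orientable F e ∧ ¬ ∃ f, f < e ∧ D.Interlaced F e f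

/-- The set of internally active elements with respect to `F`. -/
def intActive {E : Type*} [LinearOrder E] (D : DeltaMatroid E) (F : Set E) : Set E :=
  {e | e ∈ F ∧ D.Active F e}

/-- The set of externally active elements with respect to `F`. -/
def extActive {E : Type*} [LinearOrder E] (D : DeltaMatroid E) (F : Set E) : Set E :=
  {e | e ∉ F ∧ D.Active F e}

/-- The Boolean interval `I(F) = [F - int(F), F ∪ ext(F)]`. -/
def interval {E : Type*} [LinearOrder E] (D : DeltaMatroid E) (F : Set E) : Set (Set E) :=
  Set.Icc (F \ D.intActive F) (F ∪ D.extActive F)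

end DeltaMatroid

namespace Matroid

/-- The elements of a base `B` that are internally active in the sense of Tutte and Crapo:
`e ∈ B` is the least element of the fundamental cocircuit `C*(B, e)`. -/
def intActive {E : Type*} [LinearOrder E] (M : Matroid E) (B : Set E) : Set E :=
  {e | e ∈ B ∧ IsLeast (M.fundCocircuit e B) e}

/-- The elements outside a base `B` that are externally active in the sense of Tutte and Crapo:
`e ∈ E - B` is the least element of the fundamental circuit `C(B, e)`. -/
def extActive {E : Type*} [LinearOrder E] (M : Matroid E) (B : Set E) : Set E :=
  {e | e ∈ M.E \ B ∧ IsLeast (M.fundCircuit e B) e}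

/-- Crapo's Boolean interval `[B - int(B), B ∪ ext(B)]` of a base `B`. -/
def crapoInterval {E : Type*} [LinearOrder E] (M : Matroid E) (B : Set E) : Set (Set E) :=
  Set.Icc (B \ M.intActive B) (B ∪ M.extActive B)

end Matroid

open scoped symmDiff

namespace DeltaMatroid

variable {E : Type*}

/-! A set `X` lies in `I(F)` exactly when every element of `X ∆ F` is active for `F`. If `X` lay in
`I(F)` and `I(G)` with `F ≠ G`, the greatest element `e` of `F ∆ G` would lie in `X ∆ F` or `X ∆ G`,
hence be active for `F` or `G`; but symmetric exchange at `e` uses some `v ≤ e`, so it is active for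
neither. To cover `X`, minimise `X ∆ F` colexicographically: an inactive `e ∈ X ∆ F` could be traded
for a smaller element. For matroids, fundamental circuits and cocircuits record which exchanges
yield bases. -/

/-- An orientable element cannot be exchanged with itself, so activity forbids exchange with any
`f ≤ e`. -/
lemma active_iff [LinearOrder E] (D : DeltaMatroid E) (F : Set E) (e : E) :
    D.Active F e ↔ ∀ f ≤ e, F ∆ {e, f} ∉ D.feasible := by
  constructor
  · rintro ⟨h, h'⟩ f hf hF
    obtain rfl | hlt := hf.eq_or_lt
    · exact h (by simpa using hF)
    · exact h' ⟨f, hlt, hlt.ne', h, hF⟩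
  · intro h
    refine ⟨fun hF ↦ h e le_rfl (by simpa using hF), ?_⟩
    rintro ⟨f, hlt, -, -, hF⟩
    exact h f hlt.le hF

/-- Activity is defined alike inside and outside `F`, so the two bounds merge into one condition. -/
lemma mem_interval_iff [LinearOrder E] (D : DeltaMatroid E) (F X : Set E) :
    X ∈ D.interval F ↔ ∀ e ∈ X ∆ F, D.Active F e := by
  simp only [interval, intActive, extActive, Set.mem_Icc, Set.subset_def,
    Set.mem_union, Set.mem_sdiff, Set.mem_ofPred_eq, Set.mem_symmDiff]
  constructor
  · rintro ⟨h₁, h₂⟩ e he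
    have := h₁ e
    have := h₂ e
    tauto
  · intro h
    refine ⟨fun e he ↦ ?_, fun e he ↦ ?_⟩ <;> have := h e <;> tauto

lemma self_mem_interval [LinearOrder E] (D : DeltaMatroid E) (F : Set E) : F ∈ D.interval F := by
  simp [mem_interval_iff]

/-- The greatest element of the symmetric difference of two feasible sets is active in neither. -/
lemma not_active_of_isGreatest [LinearOrder E] (D : DeltaMatroid E) {F G : Set E} {e : E}
    (hF : F ∈ D.feasible) (hG : G ∈ D.feasible) (he : IsGreatest (F ∆ G) e) :
    ¬ D.Active F e := by
  obtain ⟨v, hv, hFv⟩ := D.exchange F hF G hG e he.1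
  exact fun h ↦ (D.active_iff F e).1 h v (he.2 hv) hFv

lemma eq_of_mem_interval [Finite E] [LinearOrder E] (D : DeltaMatroid E) {F G X : Set E}
    (hF : F ∈ D.feasible) (hG : G ∈ D.feasible) (hXF : X ∈ D.interval F)
    (hXG : X ∈ D.interval G) : F = G := by
  by_contra hne
  have hne' : (F ∆ G).Nonempty := Set.nonempty_iff_ne_empty.2 fun h ↦ hne (symmDiff_eq_bot.1 h)
  obtain ⟨e, he⟩ := (Set.toFinite (F ∆ G)).exists_maximal hne'
  have he' : IsGreatest (F ∆ G) e := ⟨he.prop, fun x hx ↦ le_of_not_gt fun h ↦ he.not_gt hx h⟩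
  have h₁ := D.not_active_of_isGreatest hF hG he'
  have h₂ := D.not_active_of_isGreatest hG hF (symmDiff_comm F G ▸ he')
  -- `X` must agree with both `F` and `G` at `e`, where they differ.
  have h₃ := mt ((D.mem_interval_iff F X).1 hXF e) h₁
  have h₄ := mt ((D.mem_interval_iff G X).1 hXG e) h₂
  have h₅ := he'.1
  simp only [Set.mem_symmDiff] at h₃ h₄ h₅
  tauto

/-- The feasible set whose symmetric difference with `X` is colexicographically least has `X` in its
interval. -/
lemma exists_mem_interval [Finite E] [LinearOrder E] (D : DeltaMatroid E) (X : Set E) :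
    ∃ F ∈ D.feasible, X ∈ D.interval F := by
  obtain ⟨F, hF, hmin⟩ := Set.exists_min_image D.feasible
    (fun F ↦ toColex (Set.toFinite (X ∆ F)).toFinset) (Set.toFinite _) D.nonempty
  refine ⟨F, hF, (D.mem_interval_iff F X).2 fun e he ↦ (D.active_iff F e).2 fun f hfe hf ↦ ?_⟩
  -- `e` leaves the difference; only `f` can enter, and then `f < e`.
  refine (hmin _ hf).not_gt (Finset.Colex.toColex_lt_toColex_iff_exists_forall_lt.2 ⟨e, ?_⟩)
  simp only [Set.Finite.mem_toFinset, Set.mem_symmDiff, Set.mem_insert_iff,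
    Set.mem_singleton_iff] at he ⊢
  refine ⟨he, by tauto, fun b hb hb' ↦ ?_⟩
  have hbe : b ≠ e := by rintro rfl; tauto
  have hbf : b = f := by tauto
  exact lt_of_le_of_ne (hbf ▸ hfe) hbe

theorem isPartition_interval [Finite E] [LinearOrder E] (D : DeltaMatroid E) :
    Setoid.IsPartition (D.interval '' D.feasible) := by
  refine ⟨?_, fun X ↦ ?_⟩
  · rintro ⟨F, -, h⟩
    exact (h ▸ D.self_mem_interval F : F ∈ (∅ : Set (Set E)))
  · obtain ⟨F, hF, hX⟩ := D.exists_mem_interval X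
    refine ⟨_, ⟨⟨F, hF, rfl⟩, hX⟩, ?_⟩
    rintro _ ⟨⟨G, hG, rfl⟩, hXG⟩
    rw [D.eq_of_mem_interval hG hF hXG hX]

theorem injOn_interval [Finite E] [LinearOrder E] (D : DeltaMatroid E) :
    Set.InjOn D.interval D.feasible := fun F hF _ hG h ↦
  D.eq_of_mem_interval hF hG (D.self_mem_interval F) (h ▸ D.self_mem_interval F)

end DeltaMatroid

namespace Matroid

variable {E : Type*}

/-- Ordinary base exchange if `u ∈ X`; otherwise base exchange between the complements in the dual.
-/
lemma IsBase.exists_symmDiff_isBase {M : Matroid E} {X Y : Set E} (hX : M.IsBase X)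
    (hY : M.IsBase Y) {u : E} (hu : u ∈ X ∆ Y) :
    ∃ v ∈ X ∆ Y, M.IsBase (X ∆ {u, v}) := by
  obtain ⟨huX, huY⟩ | ⟨huY, huX⟩ := hu
  · obtain ⟨v, ⟨hvY, hvX⟩, hv⟩ := hX.exchange hY ⟨huX, huY⟩
    refine ⟨v, .inr ⟨hvY, hvX⟩, ?_⟩
    convert hv using 1
    ext x
    simp only [Set.mem_symmDiff, Set.mem_insert_iff, Set.mem_singleton_iff, Set.mem_sdiff]
    grind
  · obtain ⟨v, ⟨hvY, hvX⟩, hv⟩ := hX.compl_isBase_dual.exchange hY.compl_isBase_dual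
      (e := u) ⟨⟨hY.subset_ground huY, huX⟩, fun h ↦ h.2 huY⟩
    have hvX' : v ∈ X := by
      by_contra h
      exact hvX ⟨hvY.1, h⟩
    refine ⟨v, .inl ⟨hvX', hvY.2⟩, ?_⟩
    have hB := hv.compl_isBase_of_dual
    convert hB using 1
    ext x
    have (hx : x ∈ X) := hX.subset_ground hx
    have := hY.subset_ground huY
    simp only [Set.mem_symmDiff, Set.mem_insert_iff, Set.mem_singleton_iff, Set.mem_sdiff]
    grind

/-- The delta-matroid whose feasible sets are the bases of a matroid. -/
def toDeltaMatroid (M : Matroid E) : DeltaMatroid E where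
  feasible := {B | M.IsBase B}
  nonempty := M.exists_isBase
  exchange _ hX _ hY _ hu := hX.exists_symmDiff_isBase hY hu

/-- Exchanging two elements of a base gives a base only if exactly one of them lies in it. -/
lemma IsBase.mem_iff_notMem_of_symmDiff {M : Matroid E} {B : Set E} {e f : E} (hB : M.IsBase B)
    (h : M.IsBase (B ∆ {e, f})) : e ∈ B ↔ f ∉ B := by
  have he : e ∈ B ∆ {e, f} ↔ e ∉ B := by simp [Set.mem_symmDiff]
  have hf : f ∈ B ∆ {e, f} ↔ f ∉ B := by simp [Set.mem_symmDiff]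
  have hx (x : E) (hxe : x ≠ e) (hxf : x ≠ f) : x ∈ B ∆ {e, f} ↔ x ∈ B := by
    simp [Set.mem_symmDiff, hxe, hxf]
  -- If both or neither lie in `B`, the two bases are nested, hence equal.
  by_cases heB : e ∈ B <;> by_cases hfB : f ∈ B
  · have := h.eq_of_subset_isBase hB fun x ↦ by grind
    rw [this] at he
    tauto
  · tauto
  · tauto
  · have := hB.eq_of_subset_isBase h fun x ↦ by grind
    rw [← this] at he
    tauto

lemma IsBase.mem_fundCircuit_iff_symmDiff {M : Matroid E} {B : Set E} {e f : E}
    (hB : M.IsBase B) (heE : e ∈ M.E) (he : e ∉ B) (hf : f ∈ B) :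
    f ∈ M.fundCircuit e B ↔ M.IsBase (B ∆ {e, f}) := by
  have hset : B ∆ {e, f} = insert e B \ {f} := by
    ext x
    simp only [Set.mem_symmDiff, Set.mem_insert_iff, Set.mem_singleton_iff, Set.mem_sdiff]
    grind
  rw [hB.indep.mem_fundCircuit_iff (by rwa [hB.closure_eq]) he, hset]
  exact ⟨fun h ↦ hB.exchange_isBase_of_indep' hf he h, IsBase.indep⟩

variable [LinearOrder E]

lemma extActive_toDeltaMatroid {M : Matroid E} (hM : M.E = Set.univ) {B : Set E}
    (hB : M.IsBase B) : M.toDeltaMatroid.extActive B = M.extActive B := by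
  ext e
  simp only [DeltaMatroid.extActive, extActive, Set.mem_ofPred_eq, DeltaMatroid.active_iff, hM,
    Set.mem_sdiff, Set.mem_univ, true_and]
  refine and_congr_right fun he ↦ ⟨fun h ↦ ⟨M.mem_fundCircuit e B, fun f hf ↦ ?_⟩,
    fun h f hfe hF ↦ ?_⟩
  · obtain rfl | hfB := M.fundCircuit_subset_insert e B hf
    · exact le_rfl
    · refine le_of_not_ge fun hfe ↦ h f hfe ?_
      exact (hB.mem_fundCircuit_iff_symmDiff (by simp [hM]) he hfB).1 hf
  · have hfB : f ∈ B := by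
      have := hB.mem_iff_notMem_of_symmDiff hF
      tauto
    have hef := h.2 ((hB.mem_fundCircuit_iff_symmDiff (by simp [hM]) he hfB).2 hF)
    exact he (le_antisymm hfe hef ▸ hfB)

lemma intActive_toDeltaMatroid {M : Matroid E} (hM : M.E = Set.univ) {B : Set E}
    (hB : M.IsBase B) : M.toDeltaMatroid.intActive B = M.intActive B := by
  ext e
  simp only [DeltaMatroid.intActive, intActive, Set.mem_ofPred_eq, DeltaMatroid.active_iff]
  have key (he : e ∈ B) (f : E) (hf : f ∉ B) :
      f ∈ M.fundCocircuit e B ↔ M.IsBase (B ∆ {e, f}) := by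
    -- `f ∈ C*(B, e)` iff `e ∈ C(B, f)`, so the roles of `e` and `f` swap.
    rw [hB.mem_fundCocircuit_iff_mem_fundCircuit,
      hB.mem_fundCircuit_iff_symmDiff (by simp [hM]) hf he, Set.pair_comm]
  refine and_congr_right fun he ↦ ⟨fun h ↦ ⟨M.mem_fundCocircuit e B, fun f hf ↦ ?_⟩,
    fun h f hfe hF ↦ ?_⟩
  · obtain rfl | hfB := M.fundCocircuit_subset_insert_compl e B hf
    · exact le_rfl
    · exact le_of_not_ge fun hfe ↦ h f hfe ((key he f hfB.2).1 hf)
  · have hfB : f ∉ B := (hB.mem_iff_notMem_of_symmDiff hF).1 he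
    have hef := h.2 ((key he f hfB).2 hF)
    exact hfB (le_antisymm hfe hef ▸ he)

lemma interval_toDeltaMatroid {M : Matroid E} (hM : M.E = Set.univ) {B : Set E}
    (hB : M.IsBase B) : M.toDeltaMatroid.interval B = M.crapoInterval B := by
  rw [DeltaMatroid.interval, crapoInterval, intActive_toDeltaMatroid hM hB,
    extActive_toDeltaMatroid hM hB]

end Matroid

/-- First part: for a delta-matroid on a totally ordered finite set `E`, the intervals `I(F)`, one
for each feasible set `F` (so distinct feasible sets have distinct intervals), partition `2^E`.
Second part: this generalizes Crapo's partition, since each matroid on `E` is a delta-matroid whose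
activities are the Tutte-Crapo ones, and Crapo's intervals partition `2^E`. -/
theorem mainTheorem6 {E : Type*} [Finite E] [LinearOrder E] :
    (∀ D : DeltaMatroid E,
      Setoid.IsPartition (D.interval '' D.feasible) ∧ Set.InjOn D.interval D.feasible) ∧
    (∀ M : Matroid E, M.E = Set.univ →
      (∃ D : DeltaMatroid E, D.feasible = {B | M.IsBase B} ∧
        ∀ B, M.IsBase B →
          D.intActive B = M.intActive B ∧ D.extActive B = M.extActive B ∧
          D.interval B = M.crapoInterval B) ∧
      Setoid.IsPartition (M.crapoInterval '' {B | M.IsBase B}) ∧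
      Set.InjOn M.crapoInterval {B | M.IsBase B}) := by
  refine ⟨fun D ↦ ⟨D.isPartition_interval, D.injOn_interval⟩, fun M hM ↦ ?_⟩
  have h : Set.EqOn M.toDeltaMatroid.interval M.crapoInterval {B | M.IsBase B} :=
    fun B hB ↦ Matroid.interval_toDeltaMatroid hM hB
  refine ⟨⟨M.toDeltaMatroid, rfl, fun B hB ↦ ⟨Matroid.intActive_toDeltaMatroid hM hB,
    Matroid.extActive_toDeltaMatroid hM hB, h hB⟩⟩, ?_, ?_⟩
  · rw [← h.image_eq]
    exact M.toDeltaMatroid.isPartition_interval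
  · exact h.injOn_iff.1 M.toDeltaMatroid.injOn_interval
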